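/- Let $\mathrm{TT}^1_3$ be the tree pigeonhole principle for three colours: given a colouring $c : 2^{<\omega} \to \{0,1,2\}$ of the full binary tree, find a set $H \subseteq 2^{<\omega}$ on which $c$ is constant and such that $H$, ordered by the prefix relation, is isomorphic to $2^{<\omega}$. For a problem (partial multivalued function between represented spaces) $f$, let the first-order part $^1(f)$ be the greatest Weihrauch degree that is Weihrauch reducible to $f$ and has a representative with codomain $\mathbb{N}$. For a represented space $\mathbf{Y}$ let $\overline{\mathbf{Y}} = \mathbf{Y} \cup \{\bot\}$ be its completion: if deleting all zeros from $p \in \mathbb{N}^{\mathbb{N}}$ and decreasing the remaining entries by one yields an infinite sequence that is a name of some $y \in \mathbf{Y}$, then $p$ is a name of $y$ in $\overline{\mathbf{Y}}$, and every other $p$ is a name of $\bot$. Call a problem $f : \mathbf{X} \rightrightarrows \mathbf{Y}$ finitely guessable if there is a computable function that maps every name of every $x \in \operatorname{dom}(f)$ to a name of some finite sequence $(y_0,\ldots,y_{\ell-1})$ over $\overline{\mathbf{Y}}$ (a name of a finite sequence specifies its length and names of all its entries) such that $y_i \in f(x)$ for some $i < \ell$. The first-order part $^1(\mathrm{TT}^1_3)$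 exists and is not finitely guessable: there is a problem with codomain $\mathbb{N}$ that represents the degree $^1(\mathrm{TT}^1_3)$, and no representative of this degree is finitely guessable. -/

import Mathlib

namespace Weihrauch

/-- Baire space `ℕ^ℕ`. -/
abbrev Baire : Type := ℕ → ℕ

/-- The finite word `p(0) ⋯ p(n-1)`. -/
def initial (p : Baire) (n : ℕ) : List ℕ := (List.range n).map p

/-- The pairing `⟨p, q⟩` on Baire space: `p` on even positions, `q` on odd positions. -/
def pairing (p q : Baire) : Baire := fun n => if n % 2 = 0 then p (n / 2) else q (n / 2)

/-- A computable word function that is monotone for the prefix order. Such functions are the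
machines that compute partial functions on Baire space. -/
def IsMachine (φ : List ℕ → List ℕ) : Prop :=
  Computable φ ∧ ∀ u v : List ℕ, u <+: v → φ u <+: φ v

/-- On input `p`, the machine `φ` writes the infinite sequence `q`: the words `φ (p(0) ⋯ p(n-1))`,
which form a chain, converge to `q`. The partial function on Baire space computed by `φ` has as its
domain those `p` for which there is such a `q`. -/
def Outputs (φ : List ℕ → List ℕ) (p q : Baire) : Prop :=
  ∀ m : ℕ, ∃ n : ℕ, initial q m <+: φ (initial p n)

/-- A represented space: a set `X` with a partial surjection `δ` from Baire space onto it, given by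
its graph: `IsName p x` says that `δ p` is defined and equal to `x`. -/
class RepresentedSpace (X : Type) where
  IsName : Baire → X → Prop
  unique : ∀ {p : Baire} {x y : X}, IsName p x → IsName p y → x = y
  exists_name : ∀ x : X, ∃ p : Baire, IsName p x

open RepresentedSpace

/-- A problem, i.e. a partial multivalued function `X ⇉ Y`: `f x` is the set of solutions
to the instance `x`. -/
abbrev Problem (X Y : Type) : Type := X → Set Y

/-- The domain of a problem: the instances that have a solution. -/
def dom {X Y : Type} (f : Problem X Y) : Set X := {x | (f x).Nonempty}

/-- A problem is computable if some machine maps every name of every instance to a name of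
some solution. -/
def IsComputable {X Y : Type} [RepresentedSpace X] [RepresentedSpace Y] (f : Problem X Y) : Prop :=
  ∃ φ : List ℕ → List ℕ, IsMachine φ ∧
    ∀ x ∈ dom f, ∀ p : Baire, IsName p x → ∃ q : Baire, Outputs φ p q ∧ ∃ y ∈ f x, IsName q y

/-- Weihrauch reducibility `f ≤_W g`, with inner reduction witness `κ` and outer reduction
witness `η`. -/
def Reducible {X Y Z W : Type} [RepresentedSpace X] [RepresentedSpace Y] [RepresentedSpace Z]
    [RepresentedSpace W] (f : Problem X Y) (g : Problem Z W) : Prop :=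
  ∃ κ η : List ℕ → List ℕ, IsMachine κ ∧ IsMachine η ∧
    ∀ x ∈ dom f, ∀ p : Baire, IsName p x →
      ∃ r : Baire, Outputs κ p r ∧ ∃ z ∈ dom g, IsName r z ∧
        ∀ w ∈ g z, ∀ q : Baire, IsName q w →
          ∃ s : Baire, Outputs η (pairing p q) s ∧ ∃ y ∈ f x, IsName s y

/-- The natural numbers, with `p` a name of `p 0`. -/
instance : RepresentedSpace ℕ where
  IsName p n := p 0 = n
  unique h h' := h.symm.trans h'
  exists_name n := ⟨fun _ => n, rfl⟩

/-- For `p` with infinitely many nonzero entries, the sequence that arises from `p` by deleting all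
zeros and decreasing the other entries by one. -/
noncomputable def strip (p : Baire) : Baire := fun n => p (Nat.nth (fun i => p i ≠ 0) n) - 1

/-- `p` is a delayed name of `y`: deleting the zeros from `p` and decreasing the other entries by
one yields an infinite sequence that is a name of `y`. -/
def IsDelayedName {Y : Type} [RepresentedSpace Y] (p : Baire) (y : Y) : Prop :=
  {i | p i ≠ 0}.Infinite ∧ IsName (strip p) y

/-- The completion of a represented space `Y`: a point `⊥` is added, and every `p` that is not
a delayed name of an element of `Y` is a name of `⊥`. -/
instance {Y : Type} [RepresentedSpace Y] : RepresentedSpace (WithBot Y) where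
  IsName p y := match y with
    | none => ∀ z : Y, ¬ IsDelayedName p z
    | some z => IsDelayedName p z
  unique := by
    rintro p (_ | x) (_ | y) hx hy
    · rfl
    · exact absurd hy (hx y)
    · exact absurd hx (hy x)
    · exact congrArg some (unique hx.2 hy.2)
  exists_name := by
    rintro (_ | y)
    · exact ⟨fun _ => 0, fun z hz => hz.1 (by simp)⟩
    · obtain ⟨p, hp⟩ := exists_name y
      refine ⟨fun i => p i + 1, ?_, ?_⟩
      · simpa using Set.infinite_univ
      · have : strip (fun i => p i + 1) = p := by
          funext n
          simp [strip, Nat.nth_true]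
        simpa [this] using hp

/-- The space of finite sequences of elements of `Y`: a name consists of the length, followed by
names of all entries. -/
instance {Y : Type} [RepresentedSpace Y] : RepresentedSpace (List Y) where
  IsName p l := p 0 = l.length ∧
    ∀ (i : ℕ) (h : i < l.length), IsName (fun n => p (Nat.pair i n + 1)) l[i]
  unique := by
    rintro p l l' ⟨h, hl⟩ ⟨h', hl'⟩
    exact List.ext_getElem (h.symm.trans h') fun i h₁ h₂ => unique (hl i h₁) (hl' i h₂)
  exists_name := by
    intro l
    choose name hname using fun y : Y => exists_name y
    refine ⟨fun m => m.casesOn l.length fun j =>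
      if h : j.unpair.1 < l.length then name l[j.unpair.1] j.unpair.2 else 0, rfl, fun i h => ?_⟩
    simpa [h] using hname l[i]

/-- The guessing version of a problem: a solution is a finite sequence of elements of the completed
codomain, at least one of which is a solution to the original problem. -/
def guess {X Y : Type} (f : Problem X Y) : Problem X (List (WithBot Y)) :=
  fun x => {l | ∃ y ∈ f x, (y : WithBot Y) ∈ l}

/-- Finite guessability. -/
def FinitelyGuessable {X Y : Type} [RepresentedSpace X] [RepresentedSpace Y]
    (f : Problem X Y) : Prop :=
  IsComputable (guess f)

/-- `g` is a representative of the first-order part of (the Weihrauch degree of) `f`: the degree of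
`g` is the greatest one among the degrees that are reducible to `f` and have a representative with
codomain `ℕ`. -/
def IsFirstOrderPart {X Y Z W : Type} [RepresentedSpace X] [RepresentedSpace Y] [RepresentedSpace Z]
    [RepresentedSpace W] (g : Problem X Y) (f : Problem Z W) : Prop :=
  (∃ (V : Type) (_ : RepresentedSpace V) (h : Problem V ℕ), Reducible g h ∧ Reducible h g) ∧
    Reducible g f ∧
    ∀ (V : Type) (_ : RepresentedSpace V) (h : Problem V ℕ), Reducible h f → Reducible h g

/-- The `k`-colourings of the vertices of the full binary tree `2^{<ω}`. -/
abbrev Colouring (k : ℕ) : Type := List Bool → Fin k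

/-- A name of a colouring lists the colours of the vertices, through their standard codes. -/
instance (k : ℕ) : RepresentedSpace (Colouring k) where
  IsName p c := ∀ σ : List Bool, p (Encodable.encode σ) = (c σ : ℕ)
  unique h h' := funext fun σ => Fin.ext ((h σ).symm.trans (h' σ))
  exists_name c := ⟨fun n => (((Encodable.decode n : Option (List Bool)).map c).map Fin.val).getD 0,
    fun σ => by simp⟩

open Classical in
/-- A set of vertices of the full binary tree is named by its characteristic function. -/
noncomputable instance : RepresentedSpace (Set (List Bool)) where
  IsName p H := ∀ σ : List Bool, p (Encodable.encode σ) = if σ ∈ H then 1 else 0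
  unique {p H H'} h h' := by
    ext σ
    have := (h σ).symm.trans (h' σ)
    by_cases h₁ : σ ∈ H <;> by_cases h₂ : σ ∈ H' <;> simp_all
  exists_name H := ⟨fun n => if ∃ σ ∈ H, Encodable.encode σ = n then 1 else 0, fun σ => by simp⟩

/-- `H`, ordered by the prefix relation, is isomorphic to the full binary tree. -/
def IsCopy (H : Set (List Bool)) : Prop :=
  ∃ e : List Bool → List Bool, Set.range e = H ∧ ∀ σ τ : List Bool, σ <+: τ ↔ e σ <+: e τ

/-- The tree pigeonhole principle `TT^1_k`: given a `k`-colouring of the full binary tree, find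
a monochromatic subset that is isomorphic to the full binary tree. -/
def TT (k : ℕ) : Problem (Colouring k) (Set (List Bool)) :=
  fun c => {H | IsCopy H ∧ ∃ i : Fin k, ∀ σ ∈ H, c σ = i}

end Weihrauch

/-! Every problem has a first-order part (`isFirstOrderPart_firstOrder`): pair an instance with a
continuous functional from names of solutions to numbers and ask for one of its values.

For the negative half, `candidate 3` asks for a finite piece `(ρ, L)` of a solution to a settled
colouring. It reduces to `TT 3` (`candidate_reducible_TT`), hence to every representative of the
first-order part, so finite guessability of one of these would give a continuous finite guessing
scheme for candidates. `not_isGuessing` defeats any such scheme. The constant colouring 0 yields a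
level `t` such that colourings vanishing below level `t` have correct guesses at indices below `t`
only. Colour everything from level `t` on by 1 and 2. A correct guess depends on finitely many
levels; past them, recolour above elements of its `L` so that no solution contains the candidate.
The guess at that index is now pinned to a wrong value, so the next correct guess has a fresh index
(`Stage.exists_succ`), which can happen at most `t` times.

A candidate rooted below level `t` has colour 0 and fails at once. Any other has more than `t`
elements in `L`, so one of them lies below no refuted root (`exists_isPure`), and recolouring above
such pure elements suffices. It does not revive earlier candidates: comparable pure elements force
equal root colours (`colour_root_eq`), so the new colour is wrong for both. -/

namespace Weihrauch

open RepresentedSpace Encodable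

/-! ### Prefixes of infinite sequences -/

section Words

theorem length_initial (p : Baire) (n : ℕ) : (initial p n).length = n := by simp [initial]

theorem getElem?_initial {p : Baire} {n i : ℕ} (h : i < n) : (initial p n)[i]? = some (p i) := by
  simp [initial, h]

theorem getD_initial {p : Baire} {n i : ℕ} (h : i < n) : (initial p n).getD i 0 = p i := by
  simp [List.getD, getElem?_initial h]

theorem take_initial {p : Baire} {m n : ℕ} (h : m ≤ n) : (initial p n).take m = initial p m := by
  simp [initial, ← List.map_take, List.take_range, h]

theorem initial_prefix {p : Baire} {m n : ℕ} (h : m ≤ n) : initial p m <+: initial p n := by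
  rw [← take_initial h]
  exact List.take_prefix _ _

theorem initial_congr {p q : Baire} {m : ℕ} (h : ∀ i < m, p i = q i) :
    initial p m = initial q m := by
  simpa [initial] using h

theorem eq_of_initial_eq {p q : Baire} {m i : ℕ} (h : initial p m = initial q m) (hi : i < m) :
    p i = q i := by
  rw [← getD_initial (p := p) hi, h, getD_initial hi]

theorem getD_of_prefix {u v : List ℕ} (h : u <+: v) {i : ℕ} (hi : i < u.length) :
    u.getD i 0 = v.getD i 0 := by
  obtain ⟨w, rfl⟩ := h
  simp [List.getD, List.getElem?_append_left hi]

theorem take_of_prefix {u v : List ℕ} (h : u <+: v) {i : ℕ} (hi : i ≤ u.length) :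
    u.take i = v.take i := by
  obtain ⟨w, rfl⟩ := h
  rw [List.take_append_of_le_length hi]

end Words

/-! ### Building monotone machines -/

section Machines

theorem computable_map_range {α : Type} [Primcodable α] {len : α → ℕ} {val : α → ℕ → ℕ}
    (hl : Computable len) (hv : Computable₂ val) :
    Computable fun a => (List.range (len a)).map (val a) := by
  have h : Computable₂ fun (a : α) (x : ℕ × List ℕ) => x.2 ++ [val a x.1] :=
    Computable.list_concat.comp (Computable.snd.comp Computable.snd)
      (hv.comp Computable.fst (Computable.fst.comp Computable.snd))
  refine (Computable.nat_rec hl (Computable.const []) h).of_eq fun a => ?_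
  induction len a with
  | zero => rfl
  | succ n ih => simp [List.range_succ, ih]

theorem isMachine_map_range {len : List ℕ → ℕ} {val : List ℕ → ℕ → ℕ} (hl : Computable len)
    (hv : Computable₂ val) (hmono : ∀ u v, u <+: v → len u ≤ len v)
    (hval : ∀ u v, u <+: v → ∀ i < len u, val u i = val v i) :
    IsMachine fun w => (List.range (len w)).map (val w) := by
  refine ⟨computable_map_range hl hv, fun u v h => ?_⟩
  have : (List.range (len u)).map (val u) = ((List.range (len v)).map (val v)).take (len u) := by
    rw [← List.map_take, List.take_range, min_eq_left (hmono u v h)]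
    exact List.map_congr_left fun i hi => hval u v h i (List.mem_range.1 hi)
  beta_reduce
  rw [this]
  exact List.take_prefix _ _

theorem outputs_map_range {len : List ℕ → ℕ} {val : List ℕ → ℕ → ℕ} {p q : Baire}
    (h : ∀ m, ∃ n, m ≤ len (initial p n) ∧ ∀ i < m, val (initial p n) i = q i) :
    Outputs (fun w => (List.range (len w)).map (val w)) p q := by
  intro m
  obtain ⟨n, hn, hv⟩ := h m
  refine ⟨n, ?_⟩
  have : initial q m = ((List.range (len (initial p n))).map (val (initial p n))).take m := by
    rw [← List.map_take, List.take_range, min_eq_left hn]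
    exact List.map_congr_left fun i hi => (hv i (List.mem_range.1 hi)).symm
  rw [this]
  exact List.take_prefix _ _

theorem isMachine_id : IsMachine id := ⟨Computable.id, fun _ _ h => h⟩

theorem outputs_id (p : Baire) : Outputs id p p := fun m => ⟨m, List.prefix_refl _⟩

/-- The letters of a word at the odd positions. -/
def oddPart (w : List ℕ) : List ℕ := (List.range (w.length / 2)).map fun i => w.getD (2 * i + 1) 0

theorem primrec_oddPart : Primrec oddPart := by
  refine Primrec.list_map (Primrec.list_range.comp (Primrec.nat_div.comp Primrec.list_length
    (Primrec.const 2))) ?_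
  exact (Primrec.list_getD 0).comp Primrec.fst
    (Primrec.nat_double_succ.comp Primrec.snd)

theorem isMachine_oddPart : IsMachine oddPart := by
  refine isMachine_map_range (len := fun w => w.length / 2) (val := fun w i => w.getD (2 * i + 1) 0)
    ?_ ?_ ?_ ?_
  · exact (Primrec.nat_div.comp Primrec.list_length (Primrec.const 2)).to_comp
  · exact ((Primrec.list_getD 0).comp Primrec.fst
      (Primrec.nat_double_succ.comp Primrec.snd)).to_comp
  · exact fun u v h => Nat.div_le_div_right h.length_le
  · exact fun u v h i hi => getD_of_prefix h (by omega)

theorem oddPart_initial (p : Baire) (n : ℕ) :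
    oddPart (initial p n) = initial (fun i => p (2 * i + 1)) (n / 2) := by
  rw [oddPart, length_initial]
  refine List.map_congr_left fun i hi => getD_initial ?_
  have := List.mem_range.1 hi
  omega

theorem outputs_oddPart (p : Baire) : Outputs oddPart p (fun i => p (2 * i + 1)) := by
  intro m
  refine ⟨2 * m, ?_⟩
  rw [oddPart_initial, Nat.mul_div_cancel_left _ two_pos]

theorem pairing_even (p q : Baire) (n : ℕ) : pairing p q (2 * n) = p n := by simp [pairing]

theorem pairing_odd (p q : Baire) (n : ℕ) : pairing p q (2 * n + 1) = q n := by
  have h : (2 * n + 1) / 2 = n := by omega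
  simp [pairing, h, Nat.add_mod]

theorem outputs_oddPart_pairing (p q : Baire) : Outputs oddPart (pairing p q) q := by
  simpa [pairing_odd] using outputs_oddPart (pairing p q)

theorem Reducible.refl {X Y : Type} [RepresentedSpace X] [RepresentedSpace Y] (f : Problem X Y) :
    Reducible f f :=
  ⟨id, oddPart, isMachine_id, isMachine_oddPart, fun x hx p hp =>
    ⟨p, outputs_id p, x, hx, hp, fun w hw q hq =>
      ⟨q, outputs_oddPart_pairing p q, w, hw, hq⟩⟩⟩

/-- A machine can search for a number that is certified by some prefix of the input. -/
theorem exists_search_machine {T : List ℕ → ℕ → Prop} (hT : PrimrecRel T) :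
    ∃ η, IsMachine η ∧ ∀ P : Baire, (∃ m n, T (initial P m) n) →
      ∃ m n, T (initial P m) n ∧ Outputs η P fun _ => n := by
  classical
  -- `j` codes a prefix length and a number. That length is at most `j`, so the verdict on `j` is
  -- final once `j` letters are read.
  let S : List ℕ → ℕ → Bool := fun w j =>
    decide (j.unpair.1 ≤ w.length ∧ T (w.take j.unpair.1) j.unpair.2)
  have hS : Primrec₂ S := by
    have hj : Primrec fun x : List ℕ × ℕ => x.2.unpair := Primrec.unpair.comp Primrec.snd
    refine PrimrecPred.decide (PrimrecPred.and ?_ ?_)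
    · exact Primrec.nat_le.comp (Primrec.fst.comp hj) (Primrec.list_length.comp Primrec.fst)
    · exact hT.comp (Primrec.list_take.comp (Primrec.fst.comp hj) Primrec.fst)
        (Primrec.snd.comp hj)
  have hSp : ∀ u v, u <+: v → ∀ j < u.length, S u j = S v j := by
    intro u v h j hj
    have h1 : j.unpair.1 ≤ u.length := (Nat.unpair_left_le j).trans hj.le
    simp [S, h1, h1.trans h.length_le, take_of_prefix h h1]
  let F : List ℕ → ℕ := fun w => (List.range w.length).findIdx (S w)
  have hF : Primrec F := Primrec.list_findIdx (Primrec.list_range.comp Primrec.list_length) hS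
  have hFlt : ∀ w, F w < w.length → S w (F w) := by
    intro w h
    have h' : F w < (List.range w.length).length := by simpa using h
    simpa using List.findIdx_getElem (w := h')
  have hFmin : ∀ w j, j < F w → S w j = false := by
    intro w j hj
    have := List.not_of_lt_findIdx hj
    simpa using this
  have hFle : ∀ w j, j < w.length → S w j → F w ≤ j := by
    intro w j _ h
    by_contra hlt
    simp [hFmin w j (not_le.1 hlt)] at h
  have hstab : ∀ u v, u <+: v → F u < u.length → F v = F u := by
    intro u v h hu
    have hl := h.length_le
    have h1 : F v ≤ F u := hFle v _ (by omega) (by rw [← hSp u v h _ hu]; exact hFlt u hu)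
    refine le_antisymm h1 (hFle u _ (by omega) ?_)
    rw [hSp u v h _ (by omega)]
    exact hFlt v (by omega)
  -- Nothing is written before a certified pair is found; this keeps the machine monotone.
  refine ⟨fun w => (List.range (if F w < w.length then w.length else 0)).map
    fun _ => (F w).unpair.2, isMachine_map_range (val := fun w _ => (F w).unpair.2) ?_ ?_ ?_ ?_, ?_⟩
  · exact (Primrec.ite (Primrec.nat_lt.comp hF Primrec.list_length) Primrec.list_length
      (Primrec.const 0)).to_comp
  · exact (Primrec.snd.comp (Primrec.unpair.comp (hF.comp Primrec.fst))).to_comp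
  · intro u v h
    have hl := h.length_le
    by_cases hu : F u < u.length
    · rw [if_pos hu, if_pos (by rw [hstab u v h hu]; omega)]
      exact hl
    · simp [hu]
  · intro u v h i hi
    by_cases hu : F u < u.length
    · simp only [hstab u v h hu]
    · simp [hu] at hi
  · rintro P ⟨m, n, hmn⟩
    have hfound : F (initial P (Nat.pair m n + 1)) < Nat.pair m n + 1 := by
      refine Nat.lt_succ_of_le (hFle _ _ (by simp [length_initial]) ?_)
      have : m ≤ Nat.pair m n := Nat.left_le_pair m n
      simp only [S, length_initial, Nat.unpair_pair, decide_eq_true_eq]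
      exact ⟨by omega, by rwa [take_initial (by omega)]⟩
    set w := initial P (Nat.pair m n + 1) with hw
    have hlt : F w < w.length := by rw [hw, length_initial]; exact hfound
    refine ⟨(F w).unpair.1, (F w).unpair.2, ?_,
      outputs_map_range (val := fun w _ => (F w).unpair.2) fun k => ?_⟩
    · have := hFlt w hlt
      simp only [S, decide_eq_true_eq, hw, length_initial] at this
      rw [← take_initial this.1]
      exact this.2
    · refine ⟨max k (Nat.pair m n + 1), ?_, fun i _ => ?_⟩
      · have hst := hstab w _ (initial_prefix (p := P) (le_max_right k _)) hlt
        rw [hst, length_initial, if_pos (lt_of_lt_of_le hfound (le_max_right _ _))]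
        exact le_max_left _ _
      · have hst := hstab w _ (initial_prefix (p := P) (le_max_right k _)) hlt
        simp only [hst]

end Machines

/-! ### Existence of the first-order part -/

section FirstOrderPart

/-- Names in `ℕ^ℕ × Z` pair an element of Baire space with a name. -/
instance bairePairing {Z : Type} [RepresentedSpace Z] : RepresentedSpace (Baire × Z) where
  IsName p x := (fun n => p (2 * n)) = x.1 ∧ IsName (fun n => p (2 * n + 1)) x.2
  unique h h' := Prod.ext (h.1.symm.trans h'.1) (unique h.2 h'.2)
  exists_name x := by
    obtain ⟨p, hp⟩ := exists_name x.2
    exact ⟨pairing x.1 p, by simp [pairing_even], by simpa [pairing_odd] using hp⟩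

/-- The canonical representative of the first-order part of `f`: an instance is an instance `z`
of `f` together with a continuous functional `u` into `ℕ`, given by its values on finite words,
that is defined on all names of solutions to `z`; its values on those names are the solutions. -/
def firstOrder {Z W : Type} [RepresentedSpace W] (f : Problem Z W) : Problem (Baire × Z) ℕ :=
  fun x => {n | (∀ w ∈ f x.2, ∀ q, IsName q w → ∃ k, x.1 (encode (initial q k)) ≠ 0) ∧
    ∃ w ∈ f x.2, ∃ q, IsName q w ∧ ∃ k, x.1 (encode (initial q k)) = n + 1}

theorem firstOrder_reducible {Z W : Type} [RepresentedSpace Z] [RepresentedSpace W]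
    (f : Problem Z W) : Reducible (firstOrder f) f := by
  -- The functional sits at the even positions of the instance's name, itself at the even positions
  -- of the pairing: hence the factor 4. The value 0 means "undefined yet" and `n + 1` means `n`.
  let T : List ℕ → ℕ → Prop := fun v n => ∃ k < v.length,
    2 * k ≤ v.length ∧ 4 * encode ((oddPart v).take k) < v.length ∧
      v.getD (4 * encode ((oddPart v).take k)) 0 = n + 1
  have hT : PrimrecRel T := by
    let R : ℕ → List ℕ × ℕ → Prop := fun k x => 2 * k ≤ x.1.length ∧
      4 * encode ((oddPart x.1).take k) < x.1.length ∧
      x.1.getD (4 * encode ((oddPart x.1).take k)) 0 = x.2 + 1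
    have hlen : Primrec fun y : ℕ × List ℕ × ℕ => y.2.1.length :=
      Primrec.list_length.comp (Primrec.fst.comp Primrec.snd)
    have hcode : Primrec fun y : ℕ × List ℕ × ℕ => 4 * encode ((oddPart y.2.1).take y.1) :=
      Primrec.nat_mul.comp (Primrec.const 4) (Primrec.encode.comp (Primrec.list_take.comp
        Primrec.fst (primrec_oddPart.comp (Primrec.fst.comp Primrec.snd))))
    have hR : PrimrecRel R := by
      refine PrimrecPred.and ?_ (PrimrecPred.and ?_ ?_)
      · exact Primrec.nat_le.comp (Primrec.nat_double.comp Primrec.fst) hlen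
      · exact Primrec.nat_lt.comp hcode hlen
      · exact Primrec.eq.comp
          ((Primrec.list_getD 0).comp (Primrec.fst.comp Primrec.snd) hcode)
          (Primrec.succ.comp (Primrec.snd.comp Primrec.snd))
    have hR' : PrimrecRel fun (b : ℕ) (x : List ℕ × ℕ) => ∃ k < b, R k x :=
      (hR.exists_mem_list.comp (Primrec.list_range.comp Primrec.fst) Primrec.snd).of_eq fun _ => by
        simp
    exact hR'.comp (Primrec.list_length.comp Primrec.fst)
      (Primrec.pair Primrec.fst Primrec.snd)
  obtain ⟨η, hη, hsearch⟩ := exists_search_machine hT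
  refine ⟨oddPart, η, isMachine_oddPart, hη, ?_⟩
  rintro ⟨u, z⟩ ⟨_, htot, w₀, hw₀, _⟩ p ⟨hpu, hpz⟩
  refine ⟨_, outputs_oddPart p, z, ⟨w₀, hw₀⟩, hpz, fun w hw q hq => ?_⟩
  have hP : ∀ j, pairing p q (4 * j) = u j := by
    intro j
    rw [show 4 * j = 2 * (2 * j) by ring, pairing_even]
    exact congrFun hpu j
  have hodd : ∀ {m k}, 2 * k ≤ m → (oddPart (initial (pairing p q) m)).take k = initial q k := by
    intro m k h
    simp only [oddPart_initial, pairing_odd]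
    exact take_initial (by omega)
  have hspec : ∃ m n, T (initial (pairing p q) m) n := by
    obtain ⟨k, hk⟩ := htot w hw q hq
    obtain ⟨n, hn⟩ := Nat.exists_eq_succ_of_ne_zero hk
    have h2 : 2 * k ≤ 2 * k + 4 * encode (initial q k) + 1 := by omega
    refine ⟨2 * k + 4 * encode (initial q k) + 1, n, k, ?_⟩
    rw [length_initial, hodd h2]
    refine ⟨by omega, h2, by omega, ?_⟩
    rw [getD_initial (by omega), hP]
    exact hn
  obtain ⟨m, n, ⟨k, -, hk, hlt, hv⟩, hout⟩ := hsearch _ hspec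
  refine ⟨_, hout, n, ⟨htot, w, hw, q, hq, k, ?_⟩, rfl⟩
  rw [length_initial] at hk hlt
  rwa [getD_initial hlt, hodd hk, hP] at hv

/-- The word that interleaves `σ` with a sufficiently long word `w`, starting with `w`. -/
def interleave (w σ : List ℕ) : List ℕ :=
  (List.range (2 * σ.length)).map fun j => if j % 2 = 0 then w.getD (j / 2) 0 else σ.getD (j / 2) 0

theorem primrec_interleave : Primrec₂ interleave := by
  refine Primrec.list_map (Primrec.list_range.comp (Primrec.nat_double.comp
    (Primrec.list_length.comp Primrec.snd))) ?_
  have hhalf : Primrec fun x : (List ℕ × List ℕ) × ℕ => x.2 / 2 :=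
    Primrec.nat_div.comp Primrec.snd (Primrec.const 2)
  exact Primrec.ite
    (Primrec.eq.comp (Primrec.nat_mod.comp Primrec.snd (Primrec.const 2)) (Primrec.const 0))
    ((Primrec.list_getD 0).comp (Primrec.fst.comp Primrec.fst) hhalf)
    ((Primrec.list_getD 0).comp (Primrec.snd.comp Primrec.fst) hhalf)

theorem interleave_of_prefix {u v σ : List ℕ} (h : u <+: v) (hσ : σ.length ≤ u.length) :
    interleave u σ = interleave v σ := by
  refine List.map_congr_left fun j hj => ?_
  have := List.mem_range.1 hj
  rw [getD_of_prefix h (by omega)]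

theorem interleave_initial {p q : Baire} {m n : ℕ} (h : m ≤ n) :
    interleave (initial p n) (initial q m) = initial (pairing p q) (2 * m) := by
  rw [interleave, length_initial]
  refine List.map_congr_left fun j hj => ?_
  have := List.mem_range.1 hj
  rw [getD_initial (by omega), getD_initial (by omega)]
  rfl

theorem length_ofNat_le (i : ℕ) : (Denumerable.ofNat (List ℕ) i).length ≤ i := by
  simpa using length_le_encode (Denumerable.ofNat (List ℕ) i)

/-- The functional that maps `q` to the first letter of the output of `η` on the pairing of `p`
and `q`, through its values on finite words; `w` is a prefix of `p`. -/
def associate (η : List ℕ → List ℕ) (w : List ℕ) (i : ℕ) : ℕ :=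
  ((η (interleave w (Denumerable.ofNat (List ℕ) i))).head?.map Nat.succ).getD 0

theorem computable_associate {η : List ℕ → List ℕ} (hη : Computable η) :
    Computable₂ (associate η) := by
  have h : Computable fun x : List ℕ × ℕ => interleave x.1 (Denumerable.ofNat (List ℕ) x.2) :=
    (primrec_interleave.comp Primrec.fst ((Primrec.ofNat (List ℕ)).comp Primrec.snd)).to_comp
  exact Computable.option_getD (Computable.option_map (Primrec.list_head?.to_comp.comp (hη.comp h))
    (Computable.succ.comp Computable.snd)) (Computable.const 0)

/-- A word with code `i` has length at most `i`, so interleaving reads at most `i` letters of the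
other word. -/
theorem associate_of_prefix (η : List ℕ → List ℕ) {u v : List ℕ} (h : u <+: v) {i : ℕ}
    (hi : i ≤ u.length) : associate η u i = associate η v i := by
  rw [associate, associate, interleave_of_prefix h ((length_ofNat_le i).trans hi)]

theorem associate_initial (η : List ℕ → List ℕ) (p q : Baire) (k : ℕ) :
    associate η (initial p (encode (initial q k))) (encode (initial q k)) =
      ((η (initial (pairing p q) (2 * k))).head?.map Nat.succ).getD 0 := by
  have hk : k ≤ encode (initial q k) := by
    simpa [length_initial] using length_le_encode (initial q k)
  rw [associate, Denumerable.ofNat_encode, interleave_initial hk]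

/-- The outer witness `η`, with the name `p` fixed, is itself a continuous functional and becomes
part of the instance; the new outer witness only copies the answer. -/
theorem reducible_firstOrder {V Z W : Type} [RepresentedSpace V] [RepresentedSpace Z]
    [RepresentedSpace W] {h : Problem V ℕ} {f : Problem Z W} (hf : Reducible h f) :
    Reducible h (firstOrder f) := by
  obtain ⟨κ, η, hκ, hη, hred⟩ := hf
  let len : List ℕ → ℕ := fun w => 2 * min w.length (κ w).length
  let val : List ℕ → ℕ → ℕ := fun w j =>
    if j % 2 = 0 then associate η w (j / 2) else (κ w).getD (j / 2) 0
  have hhalf : Primrec fun x : List ℕ × ℕ => x.2 / 2 :=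
    Primrec.nat_div.comp Primrec.snd (Primrec.const 2)
  have hval : Computable₂ val := by
    have hc : Computable fun x : List ℕ × ℕ => decide (x.2 % 2 = 0) :=
      (PrimrecPred.decide (Primrec.eq.comp (Primrec.nat_mod.comp Primrec.snd (Primrec.const 2))
        (Primrec.const 0))).to_comp
    refine (Computable.cond hc ((computable_associate hη.1).comp Computable.fst hhalf.to_comp)
      ((Primrec.list_getD 0).to_comp.comp (hκ.1.comp Computable.fst) hhalf.to_comp)).of_eq
      fun x => ?_
    by_cases hx : x.2 % 2 = 0 <;> simp [val, hx]
  have hlen : Computable len :=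
    Primrec.nat_double.to_comp.comp (Primrec.nat_min.to_comp.comp Computable.list_length
      (Computable.list_length.comp hκ.1))
  refine ⟨fun w => (List.range (len w)).map (val w), oddPart,
    isMachine_map_range hlen hval ?_ ?_, isMachine_oddPart, ?_⟩
  · intro u v huv
    have h1 := huv.length_le
    have h2 := (hκ.2 u v huv).length_le
    simp only [len]
    omega
  · intro u v huv i hi
    simp only [len] at hi
    simp only [val]
    rw [associate_of_prefix η huv (by omega), getD_of_prefix (hκ.2 u v huv) (by omega)]
  · intro x hx p hp
    obtain ⟨r, hr, z, ⟨w₀, hw₀⟩, hrz, hsol⟩ := hred x hx p hp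
    let u : Baire := fun i => associate η (initial p i) i
    have hu : ∀ q k, u (encode (initial q k)) =
        ((η (initial (pairing p q) (2 * k))).head?.map Nat.succ).getD 0 :=
      fun q k => associate_initial η p q k
    have htot : ∀ w ∈ f z, ∀ q, IsName q w → ∃ k, u (encode (initial q k)) ≠ 0 := by
      intro w hw q hq
      obtain ⟨s, hs, -⟩ := hsol w hw q hq
      obtain ⟨n, hn⟩ := hs 1
      refine ⟨n, ?_⟩
      have h1 := hn.trans (hη.2 _ _ (initial_prefix (p := pairing p q) (show n ≤ 2 * n by omega)))
      obtain ⟨t, ht⟩ := h1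
      rw [hu, ← ht]
      simp [initial]
    -- By monotonicity of `η`, any first letter written is the first letter of the final output.
    have hcorrect : ∀ w ∈ f z, ∀ q, IsName q w → ∀ k n, u (encode (initial q k)) = n + 1 →
        n ∈ h x := by
      intro w hw q hq k n hk
      obtain ⟨s, hs, y, hy, hsy⟩ := hsol w hw q hq
      obtain ⟨m, hm⟩ := hs 1
      have h1 := hm.trans (hη.2 _ _ (initial_prefix (p := pairing p q) (le_max_left m (2 * k))))
      have h2 := hη.2 _ _ (initial_prefix (p := pairing p q) (le_max_right m (2 * k)))
      obtain ⟨t, ht⟩ := h1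
      obtain ⟨t', ht'⟩ := h2
      rw [hu] at hk
      rcases hη' : η (initial (pairing p q) (2 * k)) with _ | ⟨a, l⟩
      · simp [hη'] at hk
      · rw [hη'] at hk ht'
        rw [← ht] at ht'
        simp only [initial, List.range_one, List.map_cons, List.map_nil, List.cons_append,
          List.cons.injEq] at ht'
        have : a = n := by simpa using hk
        have hsy' : s 0 = y := hsy
        rw [← this, ht'.1, hsy']
        exact hy
    refine ⟨pairing u r, outputs_map_range fun m => ?_, (u, z), ?_, ⟨?_, ?_⟩, ?_⟩
    · obtain ⟨n, hn⟩ := hr m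
      have h1 : κ (initial p n) <+: κ (initial p (max n m)) :=
        hκ.2 _ _ (initial_prefix (le_max_left _ _))
      have h2 : m ≤ (κ (initial p (max n m))).length := by
        simpa [length_initial] using (hn.trans h1).length_le
      refine ⟨max n m, ?_, fun i hi => ?_⟩
      · simp only [len, length_initial]
        have := le_max_right n m
        omega
      · simp only [val, pairing]
        split_ifs with hpar
        · refine (associate_of_prefix η (initial_prefix ?_) ?_).symm
          · have := le_max_right n m
            omega
          · rw [length_initial]
        · rw [← getD_of_prefix (hn.trans h1) (by rw [length_initial]; omega),
            getD_initial (by omega)]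
    · obtain ⟨q, hq⟩ := exists_name w₀
      obtain ⟨k, hk⟩ := htot w₀ hw₀ q hq
      obtain ⟨n, hn⟩ := Nat.exists_eq_succ_of_ne_zero hk
      exact ⟨n, htot, w₀, hw₀, q, hq, k, hn⟩
    · simp [pairing_even]
    · simpa [pairing_odd] using hrz
    · rintro n ⟨-, w, hw, q', hq', k, hk⟩ q hq
      exact ⟨q, outputs_oddPart_pairing p q, n, hcorrect w hw q' hq' k n hk, hq⟩

theorem isFirstOrderPart_firstOrder {Z W : Type} [RepresentedSpace Z] [RepresentedSpace W]
    (f : Problem Z W) : IsFirstOrderPart (firstOrder f) f :=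
  ⟨⟨_, _, firstOrder f, Reducible.refl _, Reducible.refl _⟩, firstOrder_reducible f,
    fun _ _ _ h => reducible_firstOrder h⟩

end FirstOrderPart

/-! ### Copies of the full binary tree -/

section Copies

/-- An embedding reflects the prefix order, so passing to a child strictly lengthens the image. -/
theorem IsCopy.exists_apply_eq {H : Set (List Bool)} {e : List Bool → List Bool}
    (hr : Set.range e = H) (he : ∀ σ τ : List Bool, σ <+: τ ↔ e σ <+: e τ) {y : List Bool}
    (hy : y ∈ H) (s : ℕ) : ∃ τ, y <+: e τ ∧ s ≤ (e τ).length := by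
  obtain ⟨τ, rfl⟩ := hr ▸ hy
  induction s with
  | zero => exact ⟨τ, List.prefix_refl _, Nat.zero_le _⟩
  | succ s ih =>
    obtain ⟨υ, hυ, hs⟩ := ih
    have h1 : e υ <+: e (υ ++ [true]) := (he _ _).1 (List.prefix_append _ _)
    refine ⟨υ ++ [true], hυ.trans h1, Nat.succ_le_of_lt (lt_of_le_of_lt hs ?_)⟩
    refine lt_of_le_of_ne h1.length_le fun h => ?_
    have h2 := (he (υ ++ [true]) υ).2 (by rw [h1.eq_of_length h])
    simpa using h2.length_le

theorem IsCopy.exists_long {H : Set (List Bool)} (h : IsCopy H) {y : List Bool} (hy : y ∈ H)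
    (s : ℕ) : ∃ x ∈ H, y <+: x ∧ s ≤ x.length := by
  obtain ⟨e, hr, he⟩ := h
  obtain ⟨τ, h1, h2⟩ := IsCopy.exists_apply_eq hr he hy s
  exact ⟨e τ, hr ▸ Set.mem_range_self τ, h1, h2⟩

theorem isCopy_cone (σ : List Bool) : IsCopy {x | σ <+: x} := by
  refine ⟨fun τ => σ ++ τ, ?_, fun τ υ => (List.prefix_append_right_inj σ).symm⟩
  ext x
  exact ⟨fun ⟨τ, hτ⟩ => ⟨τ, hτ⟩, fun ⟨τ, hτ⟩ => ⟨τ, hτ⟩⟩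

/-- The word `1^i 0`. -/
def onesZero (i : ℕ) : List Bool := List.replicate i true ++ [false]

theorem onesZero_prefix_iff {i j : ℕ} : onesZero i <+: onesZero j ↔ i = j := by
  refine ⟨fun h => ?_, fun h => h ▸ List.prefix_refl _⟩
  have hle : i ≤ j := by simpa [onesZero] using h.length_le
  by_contra hne
  have hlt : i < j := by omega
  obtain ⟨t, ht⟩ := h
  have := congrArg (fun l => l[i]?) ht
  simp [onesZero, List.getElem?_append, hlt] at this

end Copies

/-! ### Candidates and their reduction to the tree pigeonhole principle -/

section PartialSolutions

/-- From some level on, the colour of a vertex is inherited by all its successors. -/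
def Settled {k : ℕ} (c : Colouring k) : Prop :=
  ∃ s, ∀ x : List Bool, s ≤ x.length → c x = c (x.take s)

/-- `L` is an antichain above `ρ` with more than `|ρ|` elements, and all vertices above `ρ` with
a code up to that of `(ρ, L)` have the same colour. -/
structure IsCandidate {k : ℕ} (c : Colouring k) (ρ : List Bool) (L : List (List Bool)) : Prop where
  length_lt : ρ.length < L.length
  antichain : ∀ i < L.length, ∀ j < L.length, L.getD i [] <+: L.getD j [] → i = j
  above : ∀ l ∈ L, ρ <+: l
  colour : ∀ x, ρ <+: x → encode x ≤ encode (ρ, L) → c x = c ρ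

/-- The problem to find, given a settled colouring, a candidate that is contained in a solution
to the tree pigeonhole principle. -/
def candidate (k : ℕ) : Problem (Colouring k) ℕ := fun c =>
  {n | Settled c ∧ ∃ ρ L, encode (ρ, L) = n ∧ IsCandidate c ρ L ∧
    ∃ H ∈ TT k c, ρ ∈ H ∧ ∀ l ∈ L, l ∈ H}

theorem exists_isCandidate {k : ℕ} {c : Colouring k} (hc : Settled c) {H : Set (List Bool)}
    (hH : IsCopy H) : ∃ ρ L, IsCandidate c ρ L ∧ ρ ∈ H ∧ ∀ l ∈ L, l ∈ H := by
  obtain ⟨s, hs⟩ := hc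
  obtain ⟨e, hr, he⟩ := hH
  obtain ⟨τ, -, hτ⟩ := IsCopy.exists_apply_eq hr he (hr ▸ Set.mem_range_self []) s
  -- The words `1^i 0` form an infinite antichain; `|e τ| + 1` of their images are taken. As `e τ`
  -- reaches level `s`, everything above it has its colour.
  let a : ℕ → List Bool := fun i => e (τ ++ onesZero i)
  have hL : ∀ i < ((List.range ((e τ).length + 1)).map a).length,
      ((List.range ((e τ).length + 1)).map a).getD i [] = a i := by
    intro i hi
    simp only [List.length_map, List.length_range] at hi
    simp [List.getD, hi]
  refine ⟨e τ, (List.range ((e τ).length + 1)).map a, ⟨by simp, ?_, ?_, ?_⟩,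
    hr ▸ Set.mem_range_self τ, ?_⟩
  · intro i hi j hj h
    rw [hL i hi, hL j hj] at h
    exact onesZero_prefix_iff.1 ((List.prefix_append_right_inj τ).1 ((he _ _).2 h))
  · intro l hl
    obtain ⟨i, -, rfl⟩ := List.mem_map.1 hl
    exact (he _ _).1 (List.prefix_append _ _)
  · intro x hx _
    rw [hs x (hτ.trans hx.length_le), hs _ hτ]
    obtain ⟨t, rfl⟩ := hx
    rw [List.take_append_of_le_length hτ]
  · intro l hl
    obtain ⟨i, -, rfl⟩ := List.mem_map.1 hl
    exact hr ▸ Set.mem_range_self _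

theorem TT_nonempty_of_settled {k : ℕ} {c : Colouring k} (hc : Settled c) : (TT k c).Nonempty := by
  obtain ⟨s, hs⟩ := hc
  refine ⟨{x | List.replicate s false <+: x}, isCopy_cone _, c (List.replicate s false), ?_⟩
  rintro _ ⟨t, rfl⟩
  rw [hs _ (by simp)]
  congr 1
  simp

theorem mem_dom_candidate {k : ℕ} {c : Colouring k} : c ∈ dom (candidate k) ↔ Settled c := by
  refine ⟨fun ⟨_, h, _⟩ => h, fun h => ?_⟩
  obtain ⟨H, hH⟩ := TT_nonempty_of_settled h
  obtain ⟨ρ, L, h1, h2⟩ := exists_isCandidate h hH.1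
  exact ⟨_, h, ρ, L, rfl, h1, H, hH, h2⟩

theorem encode_fst_le {α β : Type} [Encodable α] [Encodable β] (x : α) (y : β) :
    encode x ≤ encode (x, y) := by
  rw [encode_prod_val]
  exact Nat.left_le_pair _ _

theorem encode_le_of_mem {α : Type} [Encodable α] {x : α} {L : List α} (h : x ∈ L) :
    encode x ≤ encode L := by
  induction L with
  | nil => simp at h
  | cons y L ih =>
    rw [encode_list_cons]
    rcases List.mem_cons.1 h with rfl | h
    · exact (Nat.left_le_pair _ _).trans (Nat.le_succ _)
    · exact (ih h).trans ((Nat.right_le_pair _ _).trans (Nat.le_succ _))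

theorem encode_le_of_prefix {α : Type} [Encodable α] {x y : List α} (h : x <+: y) :
    encode x ≤ encode y := by
  induction x generalizing y with
  | nil => simp
  | cons a x ih =>
    obtain ⟨t, rfl⟩ := h
    rw [List.cons_append, encode_list_cons, encode_list_cons]
    refine Nat.succ_le_succ ?_
    have := ih (List.prefix_append x t)
    rcases this.lt_or_eq with h | h
    · exact (Nat.pair_lt_pair_right _ h).le
    · rw [h]

theorem encode_mem_le {ρ l : List Bool} {L : List (List Bool)} (h : l ∈ L) :
    encode l ≤ encode (ρ, L) := by
  rw [encode_prod_val]
  exact (encode_le_of_mem h).trans (Nat.right_le_pair _ _)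

/-- The word `v`, a prefix of a pairing of names of `c` and `H`, certifies that the candidate `K`
for `c` is contained in `H`. -/
structure Certifies (v : List ℕ) (K : List Bool × List (List Bool)) : Prop where
  length_le : 2 * encode K + 2 ≤ v.length
  length_lt : K.1.length < K.2.length
  antichain : ∀ i < K.2.length, ∀ j < K.2.length, ¬ K.2.getD i [] <+: K.2.getD j [] ∨ i = j
  above : ∀ l ∈ K.2, K.1 <+: l ∧ v.getD (2 * encode l + 1) 0 = 1
  root : v.getD (2 * encode K.1 + 1) 0 = 1
  colour : ∀ i < encode K + 1, encode ((decode i : Option (List Bool)).getD []) ≠ i ∨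
    ¬ K.1 <+: (decode i : Option (List Bool)).getD [] ∨
      v.getD (2 * i) 0 = v.getD (2 * encode K.1) 0

theorem primrecRel_prefix {α : Type} [Primcodable α] :
    PrimrecRel fun x y : List α => x <+: y :=
  (Primrec.eq.comp Primrec.fst (Primrec.list_take.comp (Primrec.list_length.comp Primrec.fst)
    Primrec.snd)).of_eq fun _ => List.prefix_iff_eq_take.symm

theorem forall_lt_primrecRel {α : Type} [Primcodable α] {R : ℕ → α → Prop} (hR : PrimrecRel R) :
    PrimrecRel fun (n : ℕ) (a : α) => ∀ i < n, R i a :=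
  (hR.forall_mem_list.comp (Primrec.list_range.comp Primrec.fst) Primrec.snd).of_eq fun _ => by simp

/-- All quantifiers are bounded, and implications are phrased as disjunctions to match the closure
properties used. -/
theorem primrecRel_certifies : PrimrecRel Certifies := by
  have hv : Primrec fun y : List ℕ × List Bool × List (List Bool) => y.1 := Primrec.fst
  have hK : Primrec fun y : List ℕ × List Bool × List (List Bool) => y.2 := Primrec.snd
  have hρ := Primrec.fst.comp hK
  have hL := Primrec.snd.comp hK
  have hantichain : PrimrecPred fun y : List ℕ × List Bool × List (List Bool) =>
      ∀ i < y.2.2.length, ∀ j < y.2.2.length,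
        ¬ y.2.2.getD i [] <+: y.2.2.getD j [] ∨ i = j := by
    let R : ℕ → ℕ × List (List Bool) → Prop := fun j z =>
      ¬ z.2.getD z.1 [] <+: z.2.getD j [] ∨ z.1 = j
    have hi : Primrec fun y : ℕ × ℕ × List (List Bool) => y.2.1 := Primrec.fst.comp Primrec.snd
    have hl : Primrec fun y : ℕ × ℕ × List (List Bool) => y.2.2 := Primrec.snd.comp Primrec.snd
    have hR : PrimrecRel R := PrimrecPred.or (PrimrecPred.not (primrecRel_prefix.comp
      ((Primrec.list_getD []).comp hl hi) ((Primrec.list_getD []).comp hl Primrec.fst)))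
      (Primrec.eq.comp hi Primrec.fst)
    have hR' : PrimrecRel fun (i : ℕ) (l : List (List Bool)) =>
        ∀ j < l.length, ¬ l.getD i [] <+: l.getD j [] ∨ i = j :=
      (forall_lt_primrecRel hR).comp (Primrec.list_length.comp Primrec.snd)
        (Primrec.pair Primrec.fst Primrec.snd)
    exact (forall_lt_primrecRel hR').comp (Primrec.list_length.comp hL) hL
  have habove : PrimrecPred fun y : List ℕ × List Bool × List (List Bool) =>
      ∀ l ∈ y.2.2, y.2.1 <+: l ∧ y.1.getD (2 * encode l + 1) 0 = 1 := by
    let R : List Bool → List ℕ × List Bool → Prop := fun l z =>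
      z.2 <+: l ∧ z.1.getD (2 * encode l + 1) 0 = 1
    have hR : PrimrecRel R := PrimrecPred.and
      (primrecRel_prefix.comp (Primrec.snd.comp Primrec.snd) Primrec.fst)
      (Primrec.eq.comp ((Primrec.list_getD 0).comp (Primrec.fst.comp Primrec.snd)
        (Primrec.nat_double_succ.comp (Primrec.encode.comp Primrec.fst))) (Primrec.const 1))
    exact hR.forall_mem_list.comp hL (Primrec.pair hv hρ)
  have hcolour : PrimrecPred fun y : List ℕ × List Bool × List (List Bool) =>
      ∀ i < encode y.2 + 1, encode ((decode i : Option (List Bool)).getD []) ≠ i ∨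
        ¬ y.2.1 <+: (decode i : Option (List Bool)).getD [] ∨
          y.1.getD (2 * i) 0 = y.1.getD (2 * encode y.2.1) 0 := by
    let R : ℕ → List ℕ × List Bool → Prop := fun i z =>
      encode ((decode i : Option (List Bool)).getD []) ≠ i ∨
        ¬ z.2 <+: (decode i : Option (List Bool)).getD [] ∨
          z.1.getD (2 * i) 0 = z.1.getD (2 * encode z.2) 0
    have hx : Primrec fun y : ℕ × List ℕ × List Bool =>
        (decode y.1 : Option (List Bool)).getD [] :=
      Primrec.option_getD.comp (Primrec.decode.comp Primrec.fst) (Primrec.const [])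
    have hz : Primrec fun y : ℕ × List ℕ × List Bool => y.2.1 := Primrec.fst.comp Primrec.snd
    have hR : PrimrecRel R := PrimrecPred.or
      (PrimrecPred.not (Primrec.eq.comp (Primrec.encode.comp hx) Primrec.fst))
      (PrimrecPred.or
        (PrimrecPred.not (primrecRel_prefix.comp (Primrec.snd.comp Primrec.snd) hx))
        (Primrec.eq.comp
          ((Primrec.list_getD 0).comp hz (Primrec.nat_double.comp Primrec.fst))
          ((Primrec.list_getD 0).comp hz
            (Primrec.nat_double.comp (Primrec.encode.comp (Primrec.snd.comp Primrec.snd))))))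
    exact (forall_lt_primrecRel hR).comp (Primrec.succ.comp (Primrec.encode.comp hK))
      (Primrec.pair hv hρ)
  have hlen : PrimrecPred fun y : List ℕ × List Bool × List (List Bool) =>
      2 * encode y.2 + 2 ≤ y.1.length :=
    Primrec.nat_le.comp (Primrec.succ.comp (Primrec.nat_double_succ.comp (Primrec.encode.comp hK)))
      (Primrec.list_length.comp hv)
  have hlt : PrimrecPred fun y : List ℕ × List Bool × List (List Bool) =>
      y.2.1.length < y.2.2.length :=
    Primrec.nat_lt.comp (Primrec.list_length.comp hρ) (Primrec.list_length.comp hL)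
  have hroot : PrimrecPred fun y : List ℕ × List Bool × List (List Bool) =>
      y.1.getD (2 * encode y.2.1 + 1) 0 = 1 :=
    Primrec.eq.comp ((Primrec.list_getD 0).comp hv
      (Primrec.nat_double_succ.comp (Primrec.encode.comp hρ))) (Primrec.const 1)
  exact (hlen.and (hlt.and (hantichain.and (habove.and (hroot.and hcolour))))).of_eq fun y =>
    ⟨fun ⟨h1, h2, h3, h4, h5, h6⟩ => ⟨h1, h2, h3, h4, h5, h6⟩,
      fun ⟨h1, h2, h3, h4, h5, h6⟩ => ⟨h1, h2, h3, h4, h5, h6⟩⟩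

/-- The length bound puts every colour and membership value consulted inside the word, so the
default 0 of `getD` is never read. -/
theorem certifies_iff {k : ℕ} {c : Colouring k} {H : Set (List Bool)} {p q : Baire}
    (hp : IsName p c) (hq : IsName q H) (m : ℕ) (ρ : List Bool) (L : List (List Bool)) :
    Certifies (initial (pairing p q) m) (ρ, L) ↔
      2 * encode (ρ, L) + 2 ≤ m ∧ IsCandidate c ρ L ∧ ρ ∈ H ∧ ∀ l ∈ L, l ∈ H := by
  have hp' : ∀ σ, p (encode σ) = (c σ : ℕ) := hp
  have hq' : ∀ σ, q (encode σ) = 1 ↔ σ ∈ H := by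
    intro σ
    have := hq σ
    by_cases hσ : σ ∈ H <;> simp_all
  have heven : ∀ {i}, 2 * i < m → (initial (pairing p q) m).getD (2 * i) 0 = p i := by
    intro i hi
    rw [getD_initial hi, pairing_even]
  have hodd : ∀ {i}, 2 * i + 1 < m → (initial (pairing p q) m).getD (2 * i + 1) 0 = q i := by
    intro i hi
    rw [getD_initial hi, pairing_odd]
  have hρ : encode ρ ≤ encode (ρ, L) := encode_fst_le ρ L
  have hl : ∀ l ∈ L, encode l ≤ encode (ρ, L) := fun l hl => encode_mem_le hl
  constructor
  · rintro ⟨h1, h2, h3, h4, h5, h6⟩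
    rw [length_initial] at h1
    dsimp only at *
    refine ⟨h1, ⟨h2, fun i hi j hj h => (h3 i hi j hj).resolve_left (not_not.2 h),
      fun l hl => (h4 l hl).1, fun x hx hxn => ?_⟩, ?_, fun l hl' => ?_⟩
    · have := h6 (encode x) (by omega)
      rw [encodek, Option.getD_some, heven (by omega), heven (by omega), hp', hp'] at this
      exact Fin.ext ((this.resolve_left (not_not.2 rfl)).resolve_left (not_not.2 hx))
    · rwa [hodd (by omega), hq'] at h5
    · have := (h4 l hl').2
      have h7 := hl l hl'
      rwa [hodd (by omega), hq'] at this
  · rintro ⟨h1, ⟨h2, h3, h4, h5⟩, h6, h7⟩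
    refine ⟨by rwa [length_initial], h2, fun i hi j hj => ?_, fun l hl' => ⟨h4 l hl', ?_⟩, ?_,
      fun i hi => ?_⟩
    · exact or_iff_not_imp_left.2 fun h => h3 i hi j hj (not_not.1 h)
    · have h8 := hl l hl'
      rw [hodd (by omega), hq']
      exact h7 l hl'
    · dsimp only
      rw [hodd (by omega), hq']
      exact h6
    · refine or_iff_not_imp_left.2 fun hx => or_iff_not_imp_left.2 fun hρx => ?_
      rw [not_not] at hx hρx
      dsimp only at *
      rw [heven (by omega), heven (by omega), ← hx, hp', hp', h5 _ hρx (by omega)]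

theorem candidate_reducible_TT (k : ℕ) : Reducible (candidate k) (TT k) := by
  let dec : ℕ → List Bool × List (List Bool) := fun n =>
    (decode n : Option (List Bool × List (List Bool))).getD ([], [])
  have hdec : Primrec dec := Primrec.option_getD.comp Primrec.decode (Primrec.const ([], []))
  have hT : PrimrecRel fun v n => encode (dec n) = n ∧ Certifies v (dec n) :=
    PrimrecPred.and
      (Primrec.eq.comp (Primrec.encode.comp (hdec.comp Primrec.snd)) Primrec.snd)
      (primrecRel_certifies.comp Primrec.fst (hdec.comp Primrec.snd))
  obtain ⟨η, hη, hsearch⟩ := exists_search_machine hT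
  refine ⟨id, η, isMachine_id, hη, fun c hc p hp => ?_⟩
  have hs := mem_dom_candidate.1 hc
  refine ⟨p, outputs_id p, c, TT_nonempty_of_settled hs, hp, fun H hH q hq => ?_⟩
  obtain ⟨ρ, L, hcand⟩ := exists_isCandidate hs hH.1
  obtain ⟨m, n, ⟨hn, hcert⟩, hout⟩ := hsearch (pairing p q)
    ⟨2 * encode (ρ, L) + 2, encode (ρ, L), by
      have : dec (encode (ρ, L)) = (ρ, L) := by simp only [dec, encodek, Option.getD_some]
      rw [this]
      exact ⟨rfl, (certifies_iff hp hq _ _ _).2 ⟨le_rfl, hcand⟩⟩⟩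
  refine ⟨_, hout, n, ⟨hs, (dec n).1, (dec n).2, hn, ?_⟩, rfl⟩
  obtain ⟨-, h1, h2⟩ := (certifies_iff hp hq m (dec n).1 (dec n).2).1 hcert
  exact ⟨h1, H, hH, h2⟩

end PartialSolutions

/-! ### Finite use of machines and names -/

section Continuity

theorem outputs_continuous {φ : List ℕ → List ℕ} (hφ : IsMachine φ) {p q : Baire}
    (h : Outputs φ p q) (m : ℕ) :
    ∃ N, ∀ p' q', (∀ i < N, p i = p' i) → Outputs φ p' q' → ∀ i < m, q i = q' i := by
  obtain ⟨N, hN⟩ := h m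
  refine ⟨N, fun p' q' hp hq i hi => ?_⟩
  obtain ⟨n, hn⟩ := hq m
  rw [initial_congr hp] at hN
  have h1 := hN.trans (hφ.2 _ _ (initial_prefix (p := p') (le_max_left N n)))
  have h2 := hn.trans (hφ.2 _ _ (initial_prefix (p := p') (le_max_right N n)))
  refine eq_of_initial_eq ((List.prefix_of_prefix_length_le h1 h2 ?_).eq_of_length ?_) hi <;>
    simp [length_initial]

theorem strip_continuous {p : Baire} (h : {i | p i ≠ 0}.Infinite) (m : ℕ) :
    ∃ N, ∀ p' : Baire, (∀ i < N, p i = p' i) → ∀ i < m, strip p i = strip p' i := by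
  -- The first `m` letters kept lie strictly before this position.
  refine ⟨Nat.nth (fun i => p i ≠ 0) m, fun p' hp i hi => ?_⟩
  have hlt : Nat.nth (fun i => p i ≠ 0) i < Nat.nth (fun i => p i ≠ 0) m :=
    Nat.nth_strictMono h hi
  have hmem : p (Nat.nth (fun i => p i ≠ 0) i) ≠ 0 := Nat.nth_mem_of_infinite h i
  have hcount := Nat.count_nth_of_infinite (p := fun i => p i ≠ 0) h i
  set n := Nat.nth (fun i => p i ≠ 0) i with hn
  have hcount' : Nat.count (fun i => p' i ≠ 0) n = i := by
    rw [← hcount, Nat.count_eq_card_filter_range, Nat.count_eq_card_filter_range]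
    refine congrArg Finset.card (Finset.filter_congr fun j hj => ?_)
    rw [hp j ((Finset.mem_range.1 hj).trans hlt)]
  have hn' : Nat.nth (fun i => p' i ≠ 0) i = n := by
    rw [← hcount']
    exact Nat.nth_count (p := fun i => p' i ≠ 0) (by rwa [← hp n hlt])
  rw [strip, strip, hn', ← hn, hp n hlt]

theorem pairing_congr {p p' q q' : Baire} {m : ℕ} (hp : ∀ i < m, p i = p' i)
    (hq : ∀ i < m, q i = q' i) : ∀ i < m, pairing p q i = pairing p' q' i := by
  intro i hi
  simp only [pairing]
  split_ifs
  · exact hp _ (by omega)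
  · exact hq _ (by omega)

/-- The name of a colouring that vanishes on numbers that are not codes of vertices. -/
def colouringName {k : ℕ} (c : Colouring k) : Baire := fun i =>
  ((decode₂ (List Bool) i).map fun σ => (c σ : ℕ)).getD 0

theorem isName_colouringName {k : ℕ} (c : Colouring k) : IsName (colouringName c) c := by
  intro σ
  simp [colouringName, decode₂_encode]

/-- The code of a vertex is at least its length. -/
theorem colouringName_congr {k N : ℕ} {c c' : Colouring k}
    (h : ∀ x : List Bool, x.length < N → c x = c' x) :
    ∀ i < N, colouringName c i = colouringName c' i := by
  intro i hi
  rw [colouringName, colouringName]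
  rcases hx : decode₂ (List Bool) i with _ | x
  · rfl
  · have h1 : x.length < N := by
      refine lt_of_le_of_lt (length_le_encode x) ?_
      rwa [decode₂_eq_some.1 hx]
    simp [h x h1]

end Continuity

/-! ### The adversary colouring -/

section Adversary

/-- Abstract guessing of candidates: `G c i n` says that the `i`-th guess for `c` is the correct
candidate `n`. Correct guesses, and locally a bound on the number of guesses, are determined by
the colours of finitely many vertices. -/
structure IsGuessing (G : Colouring 3 → ℕ → ℕ → Prop) : Prop where
  exists_guess : ∀ c, Settled c → ∃ i n, G c i n
  correct : ∀ c i n, G c i n → n ∈ candidate 3 c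
  continuous : ∀ c i n, G c i n →
    ∃ N, ∀ c', (∀ x : List Bool, x.length < N → c x = c' x) → ∀ n', G c' i n' → n' = n
  bounded : ∀ c, Settled c →
    ∃ b N, ∀ c', (∀ x : List Bool, x.length < N → c x = c' x) → ∀ i n, G c' i n → i < b

/-- A guess that has been refuted: its index and the candidate `(ρ, L)`. -/
abbrev Refuted : Type := ℕ × List Bool × List (List Bool)

/-- No refuted candidate has its root above `l`. -/
def IsPure (A : List Refuted) (l : List Bool) : Prop := ∀ a ∈ A, ¬ l <+: a.2.1

/-- A stage of the construction of a colouring against a guessing scheme: the guesses in `A` have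
been refuted by the colouring `c`, which is determined by its values below level `s`. -/
structure Stage (G : Colouring 3 → ℕ → ℕ → Prop) (t : ℕ) (c : Colouring 3) (s : ℕ)
    (A : List Refuted) : Prop where
  le : t ≤ s
  zero_iff : ∀ x, c x = 0 ↔ x.length < t
  settled : ∀ x : List Bool, s ≤ x.length → c x = c (x.take s)
  isCandidate : ∀ a ∈ A, IsCandidate c a.2.1 a.2.2
  code_lt : ∀ a ∈ A, encode a.2 < s
  dead : ∀ a ∈ A, ∀ l ∈ a.2.2, IsPure A l → ∀ x, l <+: x → s ≤ x.length → c x ≠ c a.2.1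
  pinned : ∀ a ∈ A, ∀ c', (∀ x : List Bool, x.length < s → c x = c' x) →
    ∀ n, G c' a.1 n → n = encode a.2
  index_lt : ∀ a ∈ A, a.1 < t
  nodup : (A.map Prod.fst).Nodup

variable {G : Colouring 3 → ℕ → ℕ → Prop} {t s : ℕ} {c : Colouring 3} {A : List Refuted}

theorem Stage.length_le (h : Stage G t c s A) : A.length ≤ t := by
  have hsub : A.map Prod.fst ⊆ List.range t := by
    intro i hi
    obtain ⟨a, ha, rfl⟩ := List.mem_map.1 hi
    exact List.mem_range.2 (h.index_lt a ha)
  simpa using (List.subperm_of_subset h.nodup hsub).length_le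

/-- Two elements of `L` below the same refuted root would be comparable, so each refuted root spoils
at most one element. -/
theorem exists_isPure {ρ : List Bool} {L : List (List Bool)} (hL : IsCandidate c ρ L)
    (hA : A.length < L.length) : ∃ l ∈ L, IsPure A l := by
  by_contra! hcon
  have hex : ∀ i : Fin L.length, ∃ j : Fin A.length, L.getD i [] <+: (A.get j).2.1 := by
    intro i
    have hmem : L.getD i [] ∈ L := by simp [List.getD]
    have := hcon _ hmem
    simp only [IsPure] at this
    push Not at this
    obtain ⟨a, ha, hl⟩ := this
    obtain ⟨j, rfl⟩ := List.get_of_mem ha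
    exact ⟨j, hl⟩
  choose f hf using hex
  have hinj : Function.Injective f := by
    intro i j hij
    have hj := hf j
    rw [← hij] at hj
    rcases List.prefix_or_prefix_of_prefix (hf i) hj with h | h
    · exact Fin.ext (hL.antichain i i.2 j j.2 h)
    · exact Fin.ext (hL.antichain j j.2 i i.2 h).symm
  have := Fintype.card_le_of_injective f hinj
  simp only [Fintype.card_fin] at this
  omega

/-- Copies contain arbitrarily long vertices above each member. This excludes roots of colour 0,
which occurs only below level `t`; for other roots, it excludes copies through a pure element of
`L`. -/
theorem Stage.encode_notMem_candidate (h : Stage G t c s A) {a : Refuted} (ha : a ∈ A) :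
    encode a.2 ∉ candidate 3 c := by
  rintro ⟨-, ρ, L, heq, -, H, ⟨hcopy, i, hi⟩, hρ, hL⟩
  obtain ⟨j, K⟩ := a
  obtain rfl : (ρ, L) = K := encode_injective heq
  have hcand := h.isCandidate _ ha
  by_cases hlt : ρ.length < t
  · obtain ⟨x, hx, -, hlong⟩ := hcopy.exists_long hρ t
    have := (h.zero_iff x).1 ((hi x hx).trans ((hi _ hρ).symm.trans ((h.zero_iff _).2 hlt)))
    omega
  · have h1 := h.length_le
    have h2 : ρ.length < L.length := hcand.length_lt
    obtain ⟨l, hl, hpure⟩ := exists_isPure (A := A) (ρ := ρ) (L := L) hcand (by omega)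
    obtain ⟨x, hx, hlx, hlong⟩ := hcopy.exists_long (hL l hl) s
    exact h.dead _ ha l hl hpure x hlx hlong ((hi x hx).trans (hi _ hρ).symm)

/-- A nonzero colour that differs from `j`. -/
def otherColour (j : Fin 3) : Fin 3 := if j = 1 then 2 else 1

theorem otherColour_ne : ∀ j, otherColour j ≠ j := by decide

theorem otherColour_ne_zero : ∀ j, otherColour j ≠ 0 := by decide

open Classical in
/-- The colouring `c`, changed from level `s` on above the pure elements of the candidate `a`. -/
noncomputable def recolour (c : Colouring 3) (s : ℕ) (A : List Refuted) (a : Refuted) :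
    Colouring 3 := fun x =>
  if s ≤ x.length ∧ ∃ l ∈ a.2.2, IsPure A l ∧ l <+: x then otherColour (c a.2.1) else c x

theorem recolour_of_lt {a : Refuted} {x : List Bool} (h : x.length < s) :
    recolour c s A a x = c x := if_neg fun hx => by omega

theorem IsCandidate.congr {c' : Colouring 3} {ρ : List Bool} {L : List (List Bool)}
    (h : IsCandidate c ρ L) (hs : encode (ρ, L) < s)
    (hc : ∀ x : List Bool, x.length < s → c' x = c x) : IsCandidate c' ρ L := by
  refine ⟨h.length_lt, h.antichain, h.above, fun x hx hn => ?_⟩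
  have h1 := length_le_encode x
  have h2 := length_le_encode ρ
  have h3 := encode_fst_le ρ L
  rw [hc x (by omega), hc ρ (by omega), h.colour x hx hn]

/-- Comparable pure elements of two candidates have the colour of both roots. -/
theorem colour_root_eq {a b : Refuted} (ha : IsCandidate c a.2.1 a.2.2)
    (hb : IsCandidate c b.2.1 b.2.2) (hbA : b ∈ A) {l m : List Bool} (hl : l ∈ a.2.2)
    (hm : m ∈ b.2.2) (hpure : IsPure A l) (hlm : l <+: m) : c b.2.1 = c a.2.1 := by
  -- Purity rules out `l` being a prefix of the root of `b`, so `l` is above both roots, with a code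
  -- small enough for both colour conditions.
  have h1 : b.2.1 <+: l :=
    (List.prefix_or_prefix_of_prefix hlm (hb.above m hm)).resolve_left (hpure b hbA)
  rw [← ha.colour l (ha.above l hl) (encode_mem_le hl),
    hb.colour l h1 ((encode_le_of_prefix hlm).trans (encode_mem_le hm))]

theorem Stage.exists_succ (hG : IsGuessing G)
    (ht : ∀ c' : Colouring 3, (∀ x, x.length < t → c' x = 0) → ∀ i n, G c' i n → i < t)
    (h : Stage G t c s A) : ∃ c' s' a, Stage G t c' s' (a :: A) := by
  obtain ⟨i, n, hin⟩ := hG.exists_guess c ⟨s, h.settled⟩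
  obtain ⟨-, ρ, L, rfl, hcand, -⟩ := hG.correct c i n hin
  -- A refuted index can only produce its refuted candidate, which is no longer correct.
  have hi : i ∉ A.map Prod.fst := by
    intro hmem
    obtain ⟨a, ha, rfl⟩ := List.mem_map.1 hmem
    refine h.encode_notMem_candidate ha ?_
    rw [← h.pinned a ha c (fun _ _ => rfl) _ hin]
    exact hG.correct _ _ _ hin
  obtain ⟨N, hN⟩ := hG.continuous c i _ hin
  let a : Refuted := (i, ρ, L)
  -- Recolouring starts above both the use of the guess and all vertices that make `(ρ, L)` a
  -- candidate.
  let s' := max s (max N (encode (ρ, L) + 1))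
  have hs : s ≤ s' := le_max_left _ _
  have hNs : N ≤ s' := (le_max_left _ _).trans (le_max_right _ _)
  have hcode : encode (ρ, L) < s' := (le_max_right N _).trans (le_max_right s _)
  have hcandA : ∀ b ∈ a :: A, IsCandidate c b.2.1 b.2.2 :=
    List.forall_mem_cons.2 ⟨hcand, h.isCandidate⟩
  have hcodeA : ∀ b ∈ a :: A, encode b.2 < s' :=
    List.forall_mem_cons.2 ⟨hcode, fun b hb => (h.code_lt b hb).trans_le hs⟩
  have hlow : ∀ x : List Bool, x.length < s' → recolour c s' (a :: A) a x = c x :=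
    fun x hx => recolour_of_lt hx
  have hroot : ∀ b ∈ a :: A, recolour c s' (a :: A) a b.2.1 = c b.2.1 := by
    intro b hb
    have h1 := length_le_encode b.2.1
    have h2 : encode b.2.1 ≤ encode b.2 := encode_fst_le b.2.1 b.2.2
    exact hlow _ (by have := hcodeA b hb; omega)
  refine ⟨recolour c s' (a :: A) a, s', a, ⟨h.le.trans hs, fun x => ?_, fun x hx => ?_,
    fun b hb => (hcandA b hb).congr (hcodeA b hb) hlow, hcodeA, fun b hb l hl hpure x hlx hx => ?_,
    fun b hb c' hc' n hn => ?_, ?_, ?_⟩⟩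
  · by_cases hx : x.length < s'
    · rw [hlow x hx, h.zero_iff]
    · have hxt : ¬ x.length < t := by have := h.le; omega
      refine ⟨fun h0 => absurd h0 ?_, fun h0 => absurd h0 hxt⟩
      rw [recolour]
      split_ifs
      · exact otherColour_ne_zero _
      · exact fun h0 => hxt ((h.zero_iff x).1 h0)
  · have hlen : (x.take s').length = s' := by simpa using hx
    -- Elements of `L` are shorter than `s'`, so truncation to level `s'` does not affect the
    -- recolouring condition.
    have hiff : ∀ l ∈ L, l <+: x.take s' ↔ l <+: x := by
      intro l hl
      refine ⟨fun hp => hp.trans (List.take_prefix _ _), fun hp => ?_⟩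
      refine List.prefix_of_prefix_length_le hp (List.take_prefix _ _) ?_
      have h1 := length_le_encode l
      have h2 := encode_mem_le (ρ := ρ) hl
      omega
    have hc : c (x.take s') = c x := by
      rw [h.settled x (hs.trans hx), h.settled (x.take s') (by omega), List.take_take,
        min_eq_left hs]
    have hcond : (s' ≤ (x.take s').length ∧ ∃ l ∈ a.2.2, IsPure (a :: A) l ∧ l <+: x.take s') ↔
        (s' ≤ x.length ∧ ∃ l ∈ a.2.2, IsPure (a :: A) l ∧ l <+: x) :=
      and_congr (by omega) (exists_congr fun l => and_congr_right fun hl =>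
        and_congr_right fun _ => hiff l hl)
    rw [recolour, recolour, hc]
    split_ifs with hx₁ hx₂ hx₂
    · rfl
    · exact absurd (hcond.2 hx₁) hx₂
    · exact absurd (hcond.1 hx₂) hx₁
    · rfl
  · rw [hroot b hb, recolour]
    split_ifs with hre
    · obtain ⟨-, m, hm, hmpure, hmx⟩ := hre
      -- Both `l` and `m` are prefixes of `x`, hence comparable.
      have : c b.2.1 = c a.2.1 := by
        rcases List.prefix_or_prefix_of_prefix hlx hmx with hlm | hml
        · exact (colour_root_eq (hcandA b hb) hcand List.mem_cons_self hl hm hpure hlm).symm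
        · exact colour_root_eq hcand (hcandA b hb) hb hm hl hmpure hml
      rw [this]
      exact otherColour_ne _
    · rcases List.mem_cons.1 hb with rfl | hb
      · exact absurd ⟨hx, l, hl, hpure, hlx⟩ hre
      -- Purity only gets stricter as the list of refuted guesses grows.
      · exact h.dead b hb l hl (fun a' ha' => hpure a' (List.mem_cons_of_mem _ ha')) x hlx
          (hs.trans hx)
  · have hagree : ∀ x : List Bool, x.length < s' → c x = c' x := fun x hx =>
      (hlow x hx).symm.trans (hc' x hx)
    rcases List.mem_cons.1 hb with rfl | hb
    · exact hN c' (fun x hx => hagree x (by omega)) n hn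
    · exact h.pinned b hb c' (fun x hx => hagree x (by omega)) n hn
  · exact List.forall_mem_cons.2
      ⟨ht c (fun x hx => (h.zero_iff x).2 hx) i _ hin, h.index_lt⟩
  · exact List.nodup_cons.2 ⟨hi, h.nodup⟩

theorem not_isGuessing (G : Colouring 3 → ℕ → ℕ → Prop) : ¬ IsGuessing G := by
  intro hG
  obtain ⟨b, N, hb⟩ := hG.bounded (fun _ => 0) ⟨0, fun _ _ => rfl⟩
  -- Vanishing below `N` forces the bound `b` on the indices.
  let t := max b N
  have ht : ∀ c' : Colouring 3, (∀ x, x.length < t → c' x = 0) → ∀ i n, G c' i n → i < t :=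
    fun c' hc' i n hin => (hb c' (fun x hx => (hc' x (hx.trans_le (le_max_right _ _))).symm) i n
      hin).trans_le (le_max_left _ _)
  have hstage : ∀ m, ∃ c s A, Stage G t c s A ∧ A.length = m := by
    intro m
    induction m with
    | zero =>
      refine ⟨fun x => if x.length < t then 0 else 1, t, [], ⟨le_rfl, fun x => ?_, fun x hx => ?_,
        by simp, by simp, by simp, by simp, by simp, by simp⟩, rfl⟩
      · by_cases hx : x.length < t <;> simp [hx]
      · simp [hx]
    | succ m ih =>
      obtain ⟨c, s, A, h, rfl⟩ := ih
      obtain ⟨c', s', a, h'⟩ := h.exists_succ hG ht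
      exact ⟨c', s', a :: A, h', rfl⟩
  obtain ⟨c, s, A, h, hA⟩ := hstage (t + 1)
  have := h.length_le
  omega

end Adversary

/-! ### From finite guessability to a guessing scheme -/

theorem not_finitelyGuessable_of_candidate_reducible {X Y : Type} [RepresentedSpace X]
    [RepresentedSpace Y] {g : Problem X Y} (hred : Reducible (candidate 3) g) :
    ¬ FinitelyGuessable g := by
  rintro ⟨φ, hφ, hguess⟩
  obtain ⟨κ, η, hκ, hη, hred⟩ := hred
  have key : ∀ c : Colouring 3, Settled c → ∃ r q, Outputs κ (colouringName c) r ∧ Outputs φ r q ∧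
      ∃ i < q 0, {j | q (Nat.pair i j + 1) ≠ 0}.Infinite ∧
        ∃ s, Outputs η (pairing (colouringName c) (strip fun j => q (Nat.pair i j + 1))) s ∧
          s 0 ∈ candidate 3 c := by
    intro c hc
    obtain ⟨r, hr, z, hz, hrz, hsol⟩ := hred c (mem_dom_candidate.2 hc) _ (isName_colouringName c)
    have hz' : z ∈ dom (guess g) := by
      obtain ⟨y, hy⟩ := hz
      exact ⟨[(y : WithBot Y)], y, hy, List.mem_singleton_self _⟩
    obtain ⟨q, hq, l, ⟨y, hy, hyl⟩, hlen, hnames⟩ := hguess z hz' r hrz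
    obtain ⟨i, hi, hli⟩ := List.getElem_of_mem hyl
    have hname := hnames i hi
    rw [hli] at hname
    have hname' : IsDelayedName (fun j => q (Nat.pair i j + 1)) y := hname
    obtain ⟨s, hs, n, hn, hsn⟩ := hsol y hy _ hname'.2
    refine ⟨r, q, hr, hq, i, by omega, hname'.1, s, hs, ?_⟩
    have hsn' : s 0 = n := hsn
    rwa [hsn']
  -- The `i`-th guess is the outer witness applied to the `i`-th listed entry; `q 0` is the length
  -- of the list.
  refine not_isGuessing (fun c i n => n ∈ candidate 3 c ∧
    ∃ r q, Outputs κ (colouringName c) r ∧ Outputs φ r q ∧ i < q 0 ∧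
      {j | q (Nat.pair i j + 1) ≠ 0}.Infinite ∧
        ∃ s, Outputs η (pairing (colouringName c) (strip fun j => q (Nat.pair i j + 1))) s ∧
          s 0 = n) ⟨?_, ?_, ?_, ?_⟩
  · intro c hc
    obtain ⟨r, q, hr, hq, i, hi, hinf, s, hs, hmem⟩ := key c hc
    exact ⟨i, s 0, hmem, r, q, hr, hq, hi, hinf, s, hs, rfl⟩
  · exact fun c i n h => h.1
  · rintro c i n ⟨-, r, q, hr, hq, -, hinf, s, hs, rfl⟩
    -- The use is traced backwards from the first letter of the answer through `η`, the stripping of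
    -- zeros, `φ` and `κ`.
    obtain ⟨N₁, h₁⟩ := outputs_continuous hη hs 1
    obtain ⟨N₂, h₂⟩ := strip_continuous hinf N₁
    obtain ⟨N₃, h₃⟩ := outputs_continuous hφ hq (Nat.pair i N₂ + 1)
    obtain ⟨N₄, h₄⟩ := outputs_continuous hκ hr N₃
    refine ⟨max N₁ N₄, ?_⟩
    rintro c' hc' n' ⟨-, r', q', hr', hq', -, -, s', hs', rfl⟩
    have hname := colouringName_congr hc'
    have hrr := h₄ _ r' (fun j hj => hname j (hj.trans_le (le_max_right _ _))) hr'
    have hqq := h₃ _ q' hrr hq'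
    have hstrip := h₂ (fun j => q' (Nat.pair i j + 1)) fun j hj =>
      hqq _ (Nat.succ_lt_succ (Nat.pair_lt_pair_right i hj))
    exact (h₁ _ s' (pairing_congr (fun j hj => hname j (hj.trans_le (le_max_left _ _))) hstrip)
      hs' 0 one_pos).symm
  · intro c hc
    obtain ⟨r, q, hr, hq, -⟩ := key c hc
    obtain ⟨N₃, h₃⟩ := outputs_continuous hφ hq 1
    obtain ⟨N₄, h₄⟩ := outputs_continuous hκ hr N₃
    refine ⟨q 0, N₄, ?_⟩
    rintro c' hc' i n ⟨-, r', q', hr', hq', hi, -⟩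
    rw [h₃ _ q' (h₄ _ r' (colouringName_congr hc') hr') hq' 0 one_pos]
    exact hi

end Weihrauch

theorem corollary23 :
    (∃ (X : Type) (_ : Weihrauch.RepresentedSpace X) (g : Weihrauch.Problem X ℕ),
      Weihrauch.IsFirstOrderPart g (Weihrauch.TT 3)) ∧
    ∀ (X Y : Type) [Weihrauch.RepresentedSpace X] [Weihrauch.RepresentedSpace Y]
      (g : Weihrauch.Problem X Y),
      Weihrauch.IsFirstOrderPart g (Weihrauch.TT 3) → ¬ Weihrauch.FinitelyGuessable g :=
  ⟨⟨_, _, _, Weihrauch.isFirstOrderPart_firstOrder (Weihrauch.TT 3)⟩,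
    fun _ _ _ _ _ hg => Weihrauch.not_finitelyGuessable_of_candidate_reducible
      (hg.2.2 _ _ _ (Weihrauch.candidate_reducible_TT 3))⟩
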